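/- All graphs are finite and simple; $e(G)$ is the number of edges, $|G|$ the number of vertices and $\delta(G)$ the minimum degree of $G$, and $c(G)$ is the length of a longest cycle of $G$. Let $0<\alpha<10^{-5}$, $0\leq\beta<10^{-5}$ and $n\geq \alpha^{-1}/2$. If $G$ is a graph on $n$ vertices with $e(G)>\left(\frac14-\beta\right)n^2$, then one of the following conditions holds: (i) $c(G)\geq\left(\frac12+\alpha\right)n$; (ii) there exists a set $M\subset V(G)$ with $|M|<840(\alpha+2\beta)n$ such that $G-M$ has exactly two connected components $G_1,G_2$, and these satisfy \[ \left(\frac12-840(\alpha+2\beta)\right)n<|G_1|\leq|G_2|<\left(\frac12+20(\alpha+2\beta)\right)n, \] \[ \delta(G_1)\geq\frac{3n}{7},\qquad \delta(G_2)\geq\frac{3n}{7}. \] -/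

import Mathlib

/-- `c(G)`: the length of a longest cycle of `G`, and `0` if `G` has no cycle.
(For a finite graph the set of cycle lengths is bounded by the number of vertices.) -/
noncomputable def circumference {V : Type*} (G : SimpleGraph V) : ℕ :=
  sSup {k : ℕ | ∃ (v : V) (p : G.Walk v v), p.IsCycle ∧ p.length = k}

open Classical in
/-- `δ(H)`: the minimum degree of a finite graph `H` (Mathlib's `minDegree`, with the finiteness
and decidability data chosen classically). -/
noncomputable def minDeg {W : Type*} [Finite W] (H : SimpleGraph W) : ℕ :=
  letI : Fintype W := Fintype.ofFinite W
  H.minDegree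

/-! Let c be the largest integer below (1/2+α)n and put e = (α+2β)n. If (i) fails, every cycle has
length at most c, while c·n exceeds twice the number of edges by at most e·n. So G nearly attains
the Erdős–Gallai bound, and the proof is a stability version of that bound.

The first tool is `exists_separated_set`. When all degrees exceed c/2, rotations of a longest path
give a set X of fewer than c vertices that is joined to the rest only through one vertex v. Removing
X costs at most c|X| ordered adjacent pairs, which proves Erdős–Gallai (`adjPairs_self_le_mul`) by
induction. In G, low-degree vertices are first deleted (`exists_core`). The bound on the remainder
then forces X to carry almost all the pairs it could, so X is nearly complete and has nearly c
vertices (`exists_nearly_complete_set`).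

The second tool, `exists_hamiltonian_cycle`, shows that few vertices outside X have many neighbours
in X: otherwise X together with some of them would span a cycle of length c+1
(`card_filter_degIn_le`). The set R of all other vertices sends few edges to X, and as |X| is about
n/2, the edge count makes R nearly complete too (`exists_nearly_complete_set_pair`).

Finally the vertices of low degree are dropped from X and R. What is left of R lies in the core, so
it meets neighbours of X only in v; dropping v as well separates the two sets. -/

namespace LongCycle

open Classical

variable {V : Type*} {G : SimpleGraph V}

/-! ### Paths and cycles as vertex lists -/

/-- The number of neighbours of `x` in `S`. -/
noncomputable def degIn (G : SimpleGraph V) (S : Finset V) (x : V) : ℕ :=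
  (S.filter (G.Adj x)).card

/-- A list of distinct vertices of `S`, consecutive ones being adjacent. -/
def IsPathIn (G : SimpleGraph V) (S : Finset V) (l : List V) : Prop :=
  l.IsChain G.Adj ∧ l.Nodup ∧ ∀ x ∈ l, x ∈ S

/-- A cyclic list of at least three distinct vertices, consecutive ones being adjacent. -/
def IsCycleList (G : SimpleGraph V) (l : List V) : Prop :=
  l.IsChain G.Adj ∧ l.Nodup ∧ 3 ≤ l.length ∧ ∀ y ∈ l.getLast?, ∀ x ∈ l.head?, G.Adj y x

theorem exists_walk_of_isCycleList {l : List V} (h : IsCycleList G l) :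
    ∃ (v : V) (p : G.Walk v v), p.IsCycle ∧ p.length = l.length := by
  obtain ⟨hch, hnd, h3, hcl⟩ := h
  have hne : l ≠ [] := by rintro rfl; simp at h3
  let p := SimpleGraph.Walk.ofSupport l hne hch
  have hs : p.support = l := SimpleGraph.Walk.support_ofSupport hne hch
  have hp : p.IsPath := by rw [SimpleGraph.Walk.isPath_def, hs]; exact hnd
  have hl : p.length = l.length - 1 := SimpleGraph.Walk.length_ofSupport hne hch
  have hadj : G.Adj (l.getLast hne) (l.head hne) :=
    hcl _ (List.getLast?_eq_some_getLast hne) _ (List.head?_eq_some_head hne)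
  refine ⟨_, p.cons hadj, ?_, ?_⟩
  · rw [SimpleGraph.Walk.cons_isCycle_iff]
    refine ⟨hp, fun he => ?_⟩
    have := hp.length_eq_one_of_mem_edges (by rwa [Sym2.eq_swap])
    omega
  · rw [SimpleGraph.Walk.length_cons, hl]; omega

theorem isChain_reverse_adj {l : List V} (h : l.IsChain G.Adj) : l.reverse.IsChain G.Adj := by
  rw [List.isChain_reverse]
  exact h.imp fun _ _ h => h.symm

theorem exists_maximal_of_le {α : Type*} {p : α → Prop} (f : α → ℕ) (N : ℕ) (hp : ∃ a, p a)
    (hN : ∀ a, p a → f a ≤ N) : ∃ a, p a ∧ ∀ b, p b → f b ≤ f a := by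
  have hne : {k | ∃ a, p a ∧ f a = k}.Nonempty := hp.imp' f fun a ha => ⟨a, ha, rfl⟩
  have hb : BddAbove {k | ∃ a, p a ∧ f a = k} := ⟨N, by rintro _ ⟨a, ha, rfl⟩; exact hN a ha⟩
  obtain ⟨a, ha, hfa⟩ := Nat.sSup_mem hne hb
  exact ⟨a, ha, fun b hb' => hfa ▸ le_csSup hb ⟨b, hb', rfl⟩⟩

/-! ### Crossings, rotations and sets cut off by one vertex -/

theorem countP_add_countP_le {P Q : V → Prop} [DecidablePred P] [DecidablePred Q]
    (a : V) (l : List V)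
    (h : ∀ f g x y, a :: l = f ++ x :: y :: g → P x → ¬ Q y) :
    (a :: l).countP P + l.countP Q ≤ l.length + 1 := by
  induction l generalizing a with
  | nil => simpa using List.countP_le_length (p := fun x => decide (P x)) (l := [a])
  | cons b l ih =>
    have h1 := ih b fun f g x y hl => h (a :: f) g x y (by simp [hl])
    have h2 : P a → ¬ Q b := h [] l a b rfl
    by_cases ha : P a <;> by_cases hb : Q b <;> simp_all <;> omega

/-- Shift the positions of `P` one place to the right: at most one leaves the list, and none lands
on the head, which is not in `Q`. By pigeonhole a shifted position meets `Q`. All the rotation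
arguments below find their pair of consecutive vertices in this way. -/
theorem exists_crossing {P Q : V → Prop} [DecidablePred P] [DecidablePred Q]
    {a : V} {l : List V} (ha : ¬ Q a)
    (h : (a :: l).length < (a :: l).countP P + (a :: l).countP Q) :
    ∃ f g x y, a :: l = f ++ x :: y :: g ∧ P x ∧ Q y := by
  by_contra! hcon
  have := countP_add_countP_le a l fun f g x y h1 h2 h3 => hcon f g x y h1 h2 h3
  rw [List.countP_cons_of_neg (p := fun x => decide (Q x)) (by simpa using ha)] at h
  simp only [List.length_cons] at h
  omega

theorem degIn_le_countP {S : Finset V} {x : V} {l : List V}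
    (h : ∀ y ∈ S, G.Adj x y → y ∈ l) : degIn G S x ≤ l.countP (G.Adj x) := by
  rw [List.countP_eq_length_filter]
  refine le_trans (Finset.card_le_card (t := (l.filter (G.Adj x)).toFinset) ?_)
    (List.toFinset_card_le _)
  intro y hy
  simp only [Finset.mem_filter] at hy
  simp [h y hy.1 hy.2, hy.2]

theorem IsPathIn.length_le {S : Finset V} {l : List V} (h : IsPathIn G S l) :
    l.length ≤ S.card := by
  rw [← List.toFinset_card_of_nodup h.2.1]
  exact Finset.card_le_card fun x hx => h.2.2 x (by simpa using hx)

theorem exists_longest_path {S : Finset V} :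
    ∃ l, IsPathIn G S l ∧ ∀ l', IsPathIn G S l' → l'.length ≤ l.length :=
  exists_maximal_of_le List.length S.card ⟨[], by simp [IsPathIn]⟩ fun _ h => h.length_le

theorem mem_of_longest {S : Finset V} {x : V} {l : List V} (hl : IsPathIn G S (x :: l))
    (hmax : ∀ l', IsPathIn G S l' → l'.length ≤ (x :: l).length) {y : V} (hy : y ∈ S)
    (hxy : G.Adj x y) : y ∈ x :: l := by
  by_contra hn
  have := hmax (y :: x :: l) ⟨List.IsChain.cons_cons hxy.symm hl.1, List.nodup_cons.2 ⟨hn, hl.2.1⟩,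
    by simpa [hy] using hl.2.2⟩
  simp at this

/-- Pósa rotation: the edge `x v` replaces the path edge entering `v`, so the predecessor of `v`
becomes the new first vertex. -/
theorem isChain_rotate {a b : List V} {x v : V} (h : (x :: a ++ v :: b).IsChain G.Adj)
    (hx : G.Adj x v) : ((x :: a).reverse ++ v :: b).IsChain G.Adj := by
  rw [List.isChain_append] at h ⊢
  refine ⟨isChain_reverse_adj h.1, h.2.1, ?_⟩
  simpa using hx

/-- A graph with large minimum degree and no long cycle has a set of vertices, less than the
longest cycle in size, that a single vertex separates from the rest. -/
theorem exists_separated_set {c : ℕ} (hc : ∀ l, IsCycleList G l → l.length ≤ c) (hc2 : 2 ≤ c)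
    {H : Finset V} (hne : H.Nonempty) (hdeg : ∀ x ∈ H, c < 2 * degIn G H x) :
    ∃ X ⊆ H, ∃ v ∈ H, v ∉ X ∧ X.Nonempty ∧ X.card + 1 ≤ c ∧
      ∀ x ∈ X, ∀ y ∈ H, G.Adj x y → y ∈ X ∨ y = v := by
  obtain ⟨l, hl, hlmax⟩ := exists_longest_path (G := G) (S := H)
  -- a longest path together with a neighbour of its first vertex, as far along as possible
  let p : List V × V × List V → Prop := fun q =>
    IsPathIn G H (q.1 ++ q.2.1 :: q.2.2) ∧ (q.1 ++ q.2.1 :: q.2.2).length = l.length ∧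
      ∃ x a, q.1 = x :: a ∧ G.Adj x q.2.1
  obtain ⟨⟨a, v, b⟩, ⟨hpath, hlen, x, a₀, rfl, hxv⟩, hqmax⟩ :
      ∃ q, p q ∧ ∀ q', p q' → q'.1.length ≤ q.1.length := by
    refine exists_maximal_of_le _ l.length ?_ ?_
    · obtain ⟨x, t, hlt⟩ : ∃ x t, l = x :: t := by
        refine List.exists_cons_of_ne_nil ?_
        rintro rfl
        obtain ⟨x, hx⟩ := hne
        have := hlmax [x] ⟨List.isChain_singleton x, by simp, by simpa using hx⟩
        simp at this
      have hl' := hl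
      have hlmax' := hlmax
      rw [hlt] at hl' hlmax'
      have hxH : x ∈ H := hl'.2.2 x (by simp)
      have h1 := hdeg x hxH
      have h2 : 0 < degIn G H x := by omega
      obtain ⟨y, hy⟩ := Finset.card_pos.1 h2
      simp only [Finset.mem_filter] at hy
      have hyt : y ∈ t := by
        rcases List.mem_cons.1 (mem_of_longest hl' hlmax' hy.1 hy.2) with h | h
        · exact absurd hy.2 (by simp [h])
        · exact h
      obtain ⟨t₁, t₂, rfl⟩ := List.append_of_mem hyt
      exact ⟨(x :: t₁, y, t₂), hl', by simp [hlt], x, t₁, rfl, hy.2⟩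
    · rintro q ⟨-, hq, -⟩
      rw [← hq]; simp
  simp only at hpath hlen hxv
  -- neighbours of the first vertex of a rotated path
  have key : ∀ y a', (y :: a').Perm (x :: a₀) → (y :: a' ++ v :: b).IsChain G.Adj →
      ∀ z ∈ H, G.Adj y z → z ∈ x :: a₀ ++ [v] := by
    intro y a' hperm hch z hz hyz
    have hperm' : (y :: a' ++ v :: b).Perm (x :: a₀ ++ v :: b) := hperm.append_right _
    have hp' : IsPathIn G H (y :: a' ++ v :: b) :=
      ⟨hch, hperm'.nodup_iff.2 hpath.2.1, fun w hw => hpath.2.2 w (hperm'.mem_iff.1 hw)⟩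
    have hlen' := hperm'.length_eq
    have hmem : z ∈ y :: a' ++ v :: b := mem_of_longest (l := a' ++ v :: b) hp'
      (fun l' h' => by have := hlmax l' h'; rw [← hlen, ← hlen'] at this; exact this) hz hyz
    rcases List.mem_append.1 hmem with h | h
    · exact List.mem_append_left _ (hperm.mem_iff.1 h)
    · rcases List.mem_cons.1 h with h | h
      · simp [h]
      -- A neighbour beyond `v` would contradict the choice of `v` as far along as possible.
      · obtain ⟨b₁, b₂, rfl⟩ := List.append_of_mem h
        have := hqmax (y :: a' ++ v :: b₁, z, b₂)
          ⟨by simpa using hp', by simpa [hlen] using hlen'.trans hlen, y, a' ++ v :: b₁, rfl, hyz⟩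
        have h3 := hperm.length_eq
        simp at this h3
        omega
  have hxH : x ∈ H := hpath.2.2 x (by simp)
  have hvH : v ∈ H := hpath.2.2 v (by simp)
  have hchain : (x :: a₀ ++ [v]).IsChain G.Adj := (List.isChain_split.1 hpath.1).1
  have hnd : (x :: a₀ ++ [v]).Nodup :=
    hpath.2.1.sublist (List.Sublist.append_left (by simp) _)
  have hdx : degIn G H x ≤ (x :: a₀ ++ [v]).countP (G.Adj x) :=
    degIn_le_countP (key x a₀ (List.Perm.refl _) hpath.1)
  -- The edge `x v` closes this segment into a cycle.
  have hlc : (x :: a₀ ++ [v]).length ≤ c := by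
    refine hc _ ⟨hchain, hnd, ?_, ?_⟩
    · have h1 := hdeg x hxH
      have h2 : (x :: a₀ ++ [v]).countP (G.Adj x) ≤ (a₀ ++ [v]).length := by
        rw [List.cons_append, List.countP_cons_of_neg (by simp)]
        exact List.countP_le_length
      rw [List.length_append] at h2
      simp only [List.length_append, List.length_cons, List.length_nil] at h2 ⊢
      omega
    · intro y hy z hz
      rw [List.getLast?_concat] at hy
      simp at hy hz
      subst hy hz
      exact hxv.symm
  -- Every vertex before `v` can be made the first vertex of a path that keeps the tail from `v` on.
  -- The induction runs backwards along the segment: the last vertex is reached by a plain rotation,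
  -- and `w` is reached using its successor `u'`.
  have reach : ∀ d c', x :: a₀ = c' ++ d → ∀ u ∈ d,
      ∃ a', (u :: a').Perm (x :: a₀) ∧ (u :: a' ++ v :: b).IsChain G.Adj := by
    intro d
    induction d with
    | nil => simp
    | cons u d ih =>
      intro c' hcd w hw
      have ih' := ih (c' ++ [u]) (by simp [hcd])
      rcases List.mem_cons.1 hw with rfl | hw
      swap
      · exact ih' w hw
      match d, hcd, ih' with
      | [], hcd, _ =>
        have hrot := isChain_rotate hpath.1 hxv
        have hrev : (x :: a₀).reverse = w :: c'.reverse := by simp [hcd]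
        rw [hrev] at hrot
        exact ⟨c'.reverse, hrev ▸ List.reverse_perm _, hrot⟩
      | u' :: d, hcd, ih' =>
        obtain ⟨a', hperm, hch⟩ := ih' u' (by simp)
        have hu' : u' ∈ H := hpath.2.2 u' (by
          have : u' ∈ x :: a₀ := hperm.mem_iff.1 (by simp)
          exact List.mem_append_left _ this)
        have hdu : degIn G H u' ≤ (x :: a₀ ++ [v]).countP (G.Adj u') :=
          degIn_le_countP (key u' a' hperm hch)
        have h1 := hdeg x hxH
        have h2 := hdeg u' hu'
        obtain ⟨p₀, hp₀⟩ : ∃ p₀, c' ++ [w] = x :: p₀ := by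
          cases c' with
          | nil => simp at hcd; exact ⟨[], by simp [hcd.1]⟩
          | cons e c' => simp at hcd; exact ⟨c' ++ [w], by simp [hcd.1]⟩
        have hsplit : x :: a₀ ++ [v] = (x :: p₀) ++ (u' :: (d ++ [v])) := by
          rw [← hp₀, hcd]; simp
        have hsplit' : x :: a₀ ++ v :: b = (x :: p₀) ++ (u' :: (d ++ v :: b)) := by
          rw [← hp₀, hcd]; simp
        have hrevp : (x :: p₀).reverse = w :: c'.reverse := by rw [← hp₀]; simp
        have hpch := hpath.1
        rw [hsplit'] at hpch
        obtain ⟨hpc, hsc, -⟩ := List.isChain_append.1 hpch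
        rw [hsplit, List.countP_append] at hdx hdu
        rw [hsplit, List.length_append] at hlc
        -- `x` and `u'` each have more than c/2 neighbours on a segment of at most c vertices, so in
        -- one of its two pieces the counts exceed the length.
        have hor : (x :: p₀).length < (x :: p₀).countP (G.Adj u') + (x :: p₀).countP (G.Adj x) ∨
            (u' :: (d ++ [v])).length < (u' :: (d ++ [v])).countP (G.Adj x) +
              (u' :: (d ++ [v])).countP (G.Adj u') := by omega
        rcases hor with hor | hor
        -- Crossing before `u'`: the new path is `w … z`, `x … y`, `u' … v …`.
        · obtain ⟨f, g, y, z, hfg, hy, hz⟩ := exists_crossing (by simp) hor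
          have hrev : (z :: g).reverse ++ (f ++ [y]).reverse = w :: c'.reverse := by
            rw [← hrevp, hfg]; simp
          obtain ⟨g', hg'⟩ : ∃ g', (z :: g).reverse = w :: g' := by
            cases hg : (z :: g).reverse with
            | nil => simp at hg
            | cons e g' => rw [hg] at hrev; simp at hrev; exact ⟨g', by rw [hrev.1]⟩
          refine ⟨g' ++ (f ++ [y]) ++ (u' :: d), ?_, ?_⟩
          · have : w :: (g' ++ (f ++ [y]) ++ (u' :: d)) =
                (z :: g).reverse ++ (f ++ [y]) ++ (u' :: d) := by rw [hg']; simp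
            rw [this, hcd, show c' ++ w :: u' :: d = (c' ++ [w]) ++ (u' :: d) by simp, hp₀, hfg]
            refine List.Perm.append_right _ ?_
            refine List.perm_append_comm.trans ?_
            rw [show f ++ y :: z :: g = (f ++ [y]) ++ (z :: g) by simp]
            exact List.Perm.append_left _ (List.reverse_perm _)
          · have : w :: (g' ++ (f ++ [y]) ++ (u' :: d)) ++ v :: b =
                (z :: g).reverse ++ ((f ++ [y]) ++ (u' :: (d ++ v :: b))) := by rw [hg']; simp
            rw [this]
            rw [hfg, show f ++ y :: z :: g = (f ++ [y]) ++ (z :: g) by simp] at hpc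
            obtain ⟨hf, hg, -⟩ := List.isChain_append.1 hpc
            refine List.isChain_append.2 ⟨isChain_reverse_adj hg,
              List.isChain_append.2 ⟨hf, hsc, by simpa using hy.symm⟩, ?_⟩
            have hhead : ((f ++ [y]) ++ (u' :: (d ++ v :: b))).head? = some x := by
              cases f with
              | nil => simp at hfg; simp [hfg.1]
              | cons e f => simp at hfg; simp [hfg.1]
            rw [hhead]
            simpa using hz.symm
        -- Crossing from `u'` on: the new path is `w … x`, `y … u'`, `z … v …`.
        · obtain ⟨f, g, y, z, hfg, hy, hz⟩ := exists_crossing (by simp) hor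
          obtain ⟨g', hg'⟩ : ∃ g', z :: g = g' ++ [v] := by
            have : (u' :: (d ++ [v])).getLast? = (f ++ y :: z :: g).getLast? := by rw [hfg]
            have h3 : (z :: g).getLast? = some v := by
              rw [show f ++ y :: z :: g = (f ++ [y]) ++ (z :: g) by simp,
                List.getLast?_append_of_ne_nil _ (by simp)] at this
              rw [← this]; simp [List.getLast?_cons]
            exact ⟨_, (List.dropLast_append_getLast? v h3).symm⟩
          have hfull : u' :: d = (f ++ [y]) ++ g' := by
            have : (u' :: d) ++ [v] = ((f ++ [y]) ++ g') ++ [v] := by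
              rw [List.append_assoc, ← hg']; simpa using hfg
            exact List.append_cancel_right this
          refine ⟨c'.reverse ++ (f ++ [y]).reverse ++ g', ?_, ?_⟩
          · have : w :: (c'.reverse ++ (f ++ [y]).reverse ++ g') =
                (x :: p₀).reverse ++ ((f ++ [y]).reverse ++ g') := by rw [hrevp]; simp
            rw [this, hcd, show c' ++ w :: u' :: d = (c' ++ [w]) ++ (u' :: d) by simp, hp₀, hfull]
            exact (List.reverse_perm _).append ((List.reverse_perm _).append_right _)
          · have : w :: (c'.reverse ++ (f ++ [y]).reverse ++ g') ++ v :: b =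
                (x :: p₀).reverse ++ ((f ++ [y]).reverse ++ (g' ++ v :: b)) := by
              rw [hrevp]; simp
            rw [this]
            have hs' : u' :: (d ++ v :: b) = (f ++ [y]) ++ (g' ++ v :: b) := by
              rw [← List.cons_append, hfull]; simp
            rw [hs'] at hsc
            obtain ⟨hf, hg, -⟩ := List.isChain_append.1 hsc
            have hhead : (g' ++ v :: b).head? = some z := by
              cases g' with
              | nil => simp at hg'; simp [hg'.1]
              | cons e g' => simp at hg'; simp [hg'.1]
            have hlast : (f ++ [y]).reverse.getLast? = some u' := by
              cases f with
              | nil => simp at hfull; simp [hfull.1]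
              | cons e f => rw [List.getLast?_reverse]; simp at hfull; simp [hfull.1]
            refine List.isChain_append.2 ⟨isChain_reverse_adj hpc,
              List.isChain_append.2 ⟨isChain_reverse_adj hf, hg, ?_⟩, ?_⟩
            · rw [hlast, hhead]; simpa using hz
            · simpa using hy
  have hnd' : (x :: a₀).Nodup := hnd.sublist (by simp)
  refine ⟨(x :: a₀).toFinset, ?_, v, hvH, ?_, ?_, ?_, ?_⟩
  · intro y hy
    exact hpath.2.2 y (List.mem_append_left _ (by simpa using hy))
  · intro hv
    have := List.nodup_append.1 hnd
    exact this.2.2 v (by simpa using hv) v (by simp) rfl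
  · exact ⟨x, by simp⟩
  · rw [List.toFinset_card_of_nodup hnd']
    simpa using hlc
  · intro y hy z hz hyz
    obtain ⟨a', hperm, hch⟩ := reach (x :: a₀) [] rfl y (by simpa using hy)
    have := key y a' hperm hch z hz hyz
    simpa [or_assoc] using this

/-! ### Hamiltonian cycles -/

/-- The first vertex has more than `D.card` neighbours, all on the path, so some predecessor of a
neighbour lies outside `D`, and a rotation makes it the head. The last vertex stays fixed, which
allows both ends to be treated in turn. -/
theorem exists_longest_path_head_notMem {F D : Finset V}
    (hdeg : ∀ x ∈ F, D.card + 1 ≤ degIn G F x) {l : List V} (hl : IsPathIn G F l)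
    (hmax : ∀ l', IsPathIn G F l' → l'.length ≤ l.length) (hne : l ≠ []) :
    ∃ x t, x ∉ D ∧ IsPathIn G F (x :: t) ∧ (x :: t).Perm l ∧ (x :: t).getLast? = l.getLast? := by
  obtain ⟨x, t, rfl⟩ := List.exists_cons_of_ne_nil hne
  have hcount : D.card + 1 ≤ (x :: t).countP (G.Adj x) :=
    (hdeg x (hl.2.2 x (by simp))).trans
      (degIn_le_countP fun y hy hxy => mem_of_longest hl hmax hy hxy)
  have hD : (x :: t).countP (fun y => y ∈ D) ≤ D.card := by
    rw [List.countP_eq_length_filter, ← List.toFinset_card_of_nodup (hl.2.1.filter _)]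
    exact Finset.card_le_card fun y hy => by simp at hy; exact hy.2
  have hnot : (x :: t).countP (fun y => y ∉ D) + (x :: t).countP (fun y => y ∈ D) =
      (x :: t).length := by
    rw [List.length_eq_countP_add_countP (fun y => decide (y ∈ D)), add_comm]
    simp
  obtain ⟨f, g, y, z, hfg, hy, hz⟩ := exists_crossing (P := fun y => y ∉ D) (Q := G.Adj x)
    (a := x) (l := t) (by simp) (by omega)
  have hch := hl.1
  rw [hfg] at hch
  obtain ⟨f₀, hf₀⟩ : ∃ f₀, f ++ [y] = x :: f₀ := by
    cases f with
    | nil => simp at hfg; exact ⟨[], by simp [hfg.1]⟩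
    | cons e f => simp at hfg; exact ⟨f ++ [y], by simp [hfg.1]⟩
  have hfg' : x :: t = (x :: f₀) ++ z :: g := by rw [hfg, ← hf₀]; simp
  have hrev : (x :: f₀).reverse = y :: f.reverse := by rw [← hf₀]; simp
  have hrot := isChain_rotate (hfg' ▸ hl.1) hz
  have hperm : (y :: (f.reverse ++ z :: g)).Perm (x :: t) := by
    rw [hfg', ← List.cons_append, ← hrev]
    exact (List.reverse_perm _).append_right _
  rw [hrev] at hrot
  refine ⟨y, f.reverse ++ z :: g, hy, ⟨hrot, hperm.nodup_iff.2 hl.2.1, fun w hw =>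
    hl.2.2 w (hperm.mem_iff.1 hw)⟩, hperm, ?_⟩
  rw [hfg', ← List.cons_append, List.getLast?_append_of_ne_nil _ (by simp),
    List.getLast?_append_of_ne_nil _ (by simp)]

theorem IsPathIn.reverse {S : Finset V} {l : List V} (h : IsPathIn G S l) :
    IsPathIn G S l.reverse :=
  ⟨isChain_reverse_adj h.1, List.nodup_reverse.2 h.2.1, fun x hx => h.2.2 x (by simpa using hx)⟩

/-- A graph is Hamiltonian if all degrees exceed the number of vertices of degree
at most half the order. -/
theorem exists_hamiltonian_cycle {F D : Finset V} (hF : 3 ≤ F.card)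
    (hdeg : ∀ x ∈ F, D.card + 1 ≤ degIn G F x)
    (hhigh : ∀ x ∈ F, x ∉ D → F.card + 1 ≤ 2 * degIn G F x) :
    ∃ l, IsCycleList G l ∧ l.length = F.card := by
  obtain ⟨l₀, hl₀, hmax₀⟩ := exists_longest_path (G := G) (S := F)
  have hne₀ : l₀ ≠ [] := by
    rintro rfl
    obtain ⟨x, hx⟩ : F.Nonempty := Finset.card_pos.1 (by omega)
    have := hmax₀ [x] ⟨List.isChain_singleton x, by simp, by simpa using hx⟩
    simp at this
  obtain ⟨w, t₁, hw, hl₁, hp₁, -⟩ := exists_longest_path_head_notMem hdeg hl₀ hmax₀ hne₀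
  have hl₂ := hl₁.reverse
  have hp₂ : (w :: t₁).reverse.Perm l₀ := (List.reverse_perm _).trans hp₁
  obtain ⟨u, t, hu, hl, hp, hlast⟩ := exists_longest_path_head_notMem hdeg hl₂
    (fun l' h' => by rw [hp₂.length_eq]; exact hmax₀ l' h') (by simp)
  have hp' := hp.trans hp₂
  have hmax : ∀ l', IsPathIn G F l' → l'.length ≤ (u :: t).length :=
    fun l' h' => by rw [hp'.length_eq]; exact hmax₀ l' h'
  have hlast' : (u :: t).getLast? = some w := by rw [hlast]; simp
  have huF := hl.2.2 u (by simp)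
  have hwF : w ∈ F := hl.2.2 w (List.mem_of_getLast? hlast')
  have hcu : degIn G F u ≤ (u :: t).countP (G.Adj u) :=
    degIn_le_countP fun y hy hxy => mem_of_longest hl hmax hy hxy
  have hcw : degIn G F w ≤ (u :: t).countP (G.Adj w) := by
    refine degIn_le_countP fun y hy hxy => ?_
    obtain ⟨s, hs⟩ : ∃ s, (u :: t).reverse = w :: s := by
      have : (u :: t).reverse.head? = some w := by rw [List.head?_reverse, hlast']
      exact ⟨_, (List.cons_head?_tail this).symm⟩
    have := mem_of_longest (x := w) (l := s) (hs ▸ hl.reverse)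
      (fun l' h' => by rw [← hs, List.length_reverse]; exact hmax l' h') hy hxy
    rw [← hs] at this
    exact List.mem_reverse.1 this
  have hlenF := hl.length_le
  have h1 := hhigh u huF hu
  have h2 := hhigh w hwF hw
  -- Ore's argument: the ends `u`, `w` have degree sum greater than the length of the path, so two
  -- crossing chords close it into a cycle on the same vertices.
  obtain ⟨f, g, y, z, hfg, hy, hz⟩ := exists_crossing (P := G.Adj w) (Q := G.Adj u)
    (a := u) (l := t) (by simp) (by omega)
  have hlt : (u :: t).countP (G.Adj u) ≤ t.length := by
    rw [List.countP_cons_of_neg (by simp)]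
    exact List.countP_le_length
  have hfg' : u :: t = (f ++ [y]) ++ (z :: g) := by rw [hfg]; simp
  have hperm : ((f ++ [y]) ++ (z :: g).reverse).Perm (u :: t) := by
    rw [hfg']
    exact (List.reverse_perm _).append_left _
  have hcyc : IsCycleList G ((f ++ [y]) ++ (z :: g).reverse) := by
    have hch := hl.1
    rw [hfg'] at hch
    obtain ⟨hf, hg, -⟩ := List.isChain_append.1 hch
    refine ⟨List.isChain_append.2 ⟨hf, isChain_reverse_adj hg, ?_⟩, hperm.nodup_iff.2 hl.2.1, ?_, ?_⟩
    · have : (z :: g).reverse.head? = some w := by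
        rw [List.head?_reverse, ← hlast', hfg', List.getLast?_append_of_ne_nil _ (by simp)]
      rw [this]
      simpa using hy.symm
    · rw [hperm.length_eq]
      simp
      omega
    · have : ((f ++ [y]) ++ (z :: g).reverse).head? = some u := by
        cases f with
        | nil => simp at hfg; simp [hfg.1]
        | cons e f => simp at hfg; simp [hfg.1]
      rw [this, List.getLast?_append_of_ne_nil _ (by simp), List.getLast?_reverse]
      simpa using hz.symm
  refine ⟨_, hcyc, ?_⟩
  rw [hperm.length_eq]
  -- otherwise opening the cycle at a suitable vertex gives a longer path
  by_contra hlt'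
  have hclosed : ∀ v ∈ F, v ∉ u :: t → ∀ y ∈ u :: t, ¬ G.Adj v y := by
    intro v hv hvl y' hy' hadj
    obtain ⟨p, q, hpq⟩ := List.append_of_mem (hperm.mem_iff.2 hy')
    have hch := hcyc.1
    have hcl := hcyc.2.2.2
    rw [hpq] at hch hcl hperm
    obtain ⟨hpc, hqc, -⟩ := List.isChain_append.1 hch
    have hperm' : (y' :: q ++ p).Perm (u :: t) := List.perm_append_comm.trans hperm
    have hnew : (y' :: q ++ p).IsChain G.Adj := by
      refine List.isChain_append.2 ⟨hqc, hpc, fun a ha b hb => hcl a ?_ b ?_⟩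
      · rwa [List.getLast?_append_of_ne_nil _ (by simp)]
      · cases p with
        | nil => simp at hb
        | cons e p => simpa using hb
    have := hmax (v :: (y' :: q ++ p)) ⟨List.IsChain.cons_cons hadj hnew,
      List.nodup_cons.2 ⟨fun h => hvl (hperm'.mem_iff.1 h), hperm'.nodup_iff.2 hl.2.1⟩,
      fun x hx => by
        rcases List.mem_cons.1 hx with rfl | hx
        · exact hv
        · exact hl.2.2 x (hperm'.mem_iff.1 hx)⟩
    rw [List.length_cons, hperm'.length_eq] at this
    omega
  have hcard : (u :: t).toFinset.card = (u :: t).length := List.toFinset_card_of_nodup hl.2.1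
  have hsub : (u :: t).toFinset ⊆ F := fun x hx => hl.2.2 x (by simpa using hx)
  obtain ⟨v, hv, hvl⟩ : ∃ v ∈ F, v ∉ u :: t := by
    obtain ⟨v, hv, hvl⟩ := Finset.exists_of_ssubset
      (Finset.ssubset_iff_subset_ne.2 ⟨hsub, fun h => hlt' (by rw [← hcard, h])⟩)
    exact ⟨v, hv, by simpa using hvl⟩
  -- All neighbours of a missed vertex are missed, and there are too many of them to lie in `D`. So
  -- some missed vertex has more than half of `F.card` neighbours off the path, yet the path itself
  -- also has more than half the vertices.
  obtain ⟨v', hv', hvl', hvD⟩ : ∃ v ∈ F, v ∉ u :: t ∧ v ∉ D := by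
    by_contra! hcon
    have hsubD : F.filter (G.Adj v) ⊆ D := by
      intro y hy
      simp only [Finset.mem_filter] at hy
      exact hcon y hy.1 fun h => hclosed v hv hvl y h hy.2
    have := Finset.card_le_card hsubD
    have := hdeg v hv
    unfold degIn at this
    omega
  have hsub' : F.filter (G.Adj v') ⊆ F \ (u :: t).toFinset := by
    intro y hy
    simp only [Finset.mem_filter] at hy
    simp only [Finset.mem_sdiff, List.mem_toFinset]
    exact ⟨hy.1, fun h => hclosed v' hv' hvl' y h hy.2⟩
  have h3 := Finset.card_le_card hsub'
  rw [Finset.card_sdiff_of_subset hsub, hcard] at h3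
  have h4 := hhigh v' hv' hvD
  unfold degIn at h4
  simp only [List.length_cons] at h3
  omega

/-! ### Ordered adjacent pairs and the Erdős–Gallai bound -/

/-- The number of adjacent pairs in `A × B`. -/
noncomputable def adjPairs (G : SimpleGraph V) (A B : Finset V) : ℕ :=
  ∑ x ∈ A, degIn G B x

theorem adjPairs_comm (A B : Finset V) : adjPairs G A B = adjPairs G B A := by
  unfold adjPairs degIn
  simp only [Finset.card_filter]
  rw [Finset.sum_comm]
  simp only [G.adj_comm]

theorem degIn_mono {A B : Finset V} (h : A ⊆ B) (x : V) : degIn G A x ≤ degIn G B x :=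
  Finset.card_le_card (Finset.filter_subset_filter _ h)

theorem degIn_le_card (A : Finset V) (x : V) : degIn G A x ≤ A.card :=
  Finset.card_filter_le _ _

theorem degIn_succ_le_card {A : Finset V} {x : V} (hx : x ∈ A) : degIn G A x + 1 ≤ A.card := by
  have : A.filter (G.Adj x) ⊆ A.erase x := by
    intro y hy
    simp only [Finset.mem_filter] at hy
    exact Finset.mem_erase.2 ⟨hy.2.ne', hy.1⟩
  have h := Finset.card_le_card this
  rw [Finset.card_erase_of_mem hx] at h
  have := Finset.card_pos.2 ⟨x, hx⟩
  unfold degIn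
  omega

theorem degIn_sdiff {A S : Finset V} (h : A ⊆ S) (x : V) :
    degIn G S x = degIn G A x + degIn G (S \ A) x := by
  unfold degIn
  rw [← Finset.card_union_of_disjoint, ← Finset.filter_union, Finset.union_sdiff_of_subset h]
  exact Finset.disjoint_filter_filter Finset.disjoint_sdiff

theorem adjPairs_sdiff_right {A S : Finset V} (h : A ⊆ S) (T : Finset V) :
    adjPairs G T S = adjPairs G T A + adjPairs G T (S \ A) := by
  unfold adjPairs
  rw [← Finset.sum_add_distrib]
  exact Finset.sum_congr rfl fun x _ => degIn_sdiff h x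

theorem adjPairs_self_eq {A S : Finset V} (h : A ⊆ S) :
    adjPairs G S S = adjPairs G A A + 2 * adjPairs G A (S \ A) + adjPairs G (S \ A) (S \ A) := by
  rw [adjPairs_sdiff_right h S, adjPairs_comm S A, adjPairs_comm S (S \ A),
    adjPairs_sdiff_right h A, adjPairs_sdiff_right h (S \ A), adjPairs_comm (S \ A) A]
  ring

theorem adjPairs_self_erase {S : Finset V} {x : V} (hx : x ∈ S) :
    adjPairs G S S = 2 * degIn G S x + adjPairs G (S.erase x) (S.erase x) := by
  have hd : degIn G {x} x = 0 := by simp [degIn]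
  have h := adjPairs_self_eq (G := G) (Finset.singleton_subset_iff.2 hx)
  rw [h, degIn_sdiff (Finset.singleton_subset_iff.2 hx) x, Finset.sdiff_singleton_eq_erase]
  simp [adjPairs, hd]

theorem adjPairs_le_of_separated {X H : Finset V} {v : V}
    (hv : ∀ x ∈ X, ∀ y ∈ H, G.Adj x y → y ∈ X ∨ y = v) :
    adjPairs G X (H \ X) ≤ adjPairs G X {v} := by
  refine Finset.sum_le_sum fun x hx => Finset.card_le_card fun y hy => ?_
  simp only [Finset.mem_filter, Finset.mem_sdiff, Finset.mem_singleton] at hy ⊢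
  exact ⟨(hv x hx y hy.1.1 hy.2).resolve_left hy.1.2, hy.2⟩

theorem adjPairs_le_mul (A B : Finset V) : adjPairs G A B ≤ A.card * B.card := by
  rw [← smul_eq_mul]
  exact Finset.sum_le_card_nsmul _ _ _ fun x _ => degIn_le_card B x

theorem adjPairs_self_le (A : Finset V) : adjPairs G A A ≤ A.card * (A.card - 1) := by
  rw [← smul_eq_mul]
  exact Finset.sum_le_card_nsmul _ _ _ fun x hx => by have := degIn_succ_le_card (G := G) hx; omega

/-- The Erdős–Gallai bound for graphs without long cycles. -/
theorem adjPairs_self_le_mul {c : ℕ} (hc : ∀ l, IsCycleList G l → l.length ≤ c) (hc2 : 2 ≤ c)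
    (S : Finset V) : adjPairs G S S ≤ c * S.card := by
  induction S using Finset.strongInduction with
  | H S ih =>
    rcases S.eq_empty_or_nonempty with rfl | hne
    · simp [adjPairs]
    by_cases hdeg : ∀ x ∈ S, c < 2 * degIn G S x
    · obtain ⟨X, hXS, v, hv, hvX, hXne, hXc, hsep⟩ := exists_separated_set hc hc2 hne hdeg
      have h1 := ih (S \ X) (Finset.sdiff_ssubset hXS hXne)
      rw [adjPairs_self_eq hXS]
      have h2 := (adjPairs_le_of_separated hsep).trans (adjPairs_le_mul X {v})
      rw [Finset.card_singleton, mul_one] at h2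
      have h3 := adjPairs_self_le (G := G) X
      have h4 := Finset.card_sdiff_add_card_eq_card hXS
      have h5 := Finset.card_pos.2 hXne
      obtain ⟨m, hm⟩ : ∃ m, X.card = m + 1 := ⟨X.card - 1, by omega⟩
      rw [hm, Nat.add_sub_cancel] at h3
      rw [← h4]
      -- Pairs inside `X` and both orders of pairs with `v` total at most |X|(|X|-1) + 2|X| =
      -- |X|(|X|+1), which is at most c|X|.
      have h6 : (m + 1) * (m + 2) ≤ (m + 1) * c := Nat.mul_le_mul_left _ (by omega)
      rw [hm] at h2 ⊢
      nlinarith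
    · push Not at hdeg
      obtain ⟨x, hx, hxd⟩ := hdeg
      have h1 := ih (S.erase x) (Finset.erase_ssubset hx)
      rw [adjPairs_self_erase hx, ← Finset.card_erase_add_one hx]
      linarith

theorem two_mul_ncard_edgeSet [Fintype V] (G : SimpleGraph V) :
    2 * G.edgeSet.ncard = adjPairs G Finset.univ Finset.univ := by
  rw [← SimpleGraph.coe_edgeFinset, Set.ncard_coe_finset, ← G.sum_degrees_eq_twice_card_edges]
  refine Finset.sum_congr rfl fun x _ => ?_
  rw [← SimpleGraph.card_neighborFinset_eq_degree, SimpleGraph.neighborFinset_eq_filter]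
  rfl

/-! ### The core and the two nearly complete sets -/

/-- Deleting vertices of small degree keeps the number of missing edges and reaches a large
subgraph, which contains all subgraphs of large minimum degree. -/
theorem exists_core [Fintype V] {c m : ℕ} {L : ℤ}
    (hL : (c : ℤ) * Fintype.card V - adjPairs G Finset.univ Finset.univ ≤ L)
    (hm : m ≤ Fintype.card V) (hmc : L < m * ((c : ℤ) - m)) :
    ∃ H : Finset V, m ≤ H.card ∧ (c : ℤ) * H.card - adjPairs G H H ≤ L ∧
      (∀ x ∈ H, c < 2 * degIn G H x) ∧
      ∀ T : Finset V, (∀ x ∈ T, c < 2 * degIn G T x) → T ⊆ H := by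
  let p : Finset V → Prop := fun H => m ≤ H.card ∧ (c : ℤ) * H.card - adjPairs G H H ≤ L ∧
    ∀ T : Finset V, (∀ x ∈ T, c < 2 * degIn G T x) → T ⊆ H
  -- `H` is a smallest admissible set; the maximum is over the number of deleted vertices.
  obtain ⟨H, ⟨h1, h2, h3⟩, hmax⟩ : ∃ H, p H ∧ ∀ H', p H' →
      Fintype.card V - H'.card ≤ Fintype.card V - H.card :=
    exists_maximal_of_le _ (Fintype.card V) ⟨Finset.univ, by simpa using hm, by simpa using hL,
      fun T _ => Finset.subset_univ T⟩ fun _ _ => Nat.sub_le _ _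
  refine ⟨H, h1, h2, fun x hx => ?_, h3⟩
  by_contra! hd
  have hcard := Finset.card_erase_add_one hx
  have hE := adjPairs_self_erase (G := G) hx
  by_cases hlt : m ≤ (H.erase x).card
  · have := hmax (H.erase x) ⟨hlt, ?_, fun T hT y hy => Finset.mem_erase.2 ⟨?_, h3 T hT hy⟩⟩
    · have := Finset.card_le_univ H
      omega
    · rw [hE, ← hcard] at h2
      push_cast at h2 ⊢
      have : (2 * degIn G H x : ℤ) ≤ c := by exact_mod_cast hd
      linarith
    · rintro rfl
      have h4 := hT y hy
      have h5 := degIn_mono (G := G) (h3 T hT) y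
      omega
  -- Deletion cannot get down to `m` vertices: there the deficit would be at least m(c-m), more than
  -- `L`.
  · have hHm : H.card = m := by omega
    have h4 := adjPairs_le_mul (G := G) H H
    rw [hHm] at h2 h4
    have h5 : (adjPairs G H H : ℤ) ≤ m * m := by exact_mod_cast h4
    nlinarith

/-- Markov's inequality, used to turn a small total deficit into a small number of low-degree
vertices. -/
theorem card_filter_mul_le_of_sum_le {ι : Type*} {s : Finset ι} {f : ι → ℝ} {P : ι → Prop}
    {t T : ℝ} (hf : ∀ i ∈ s, 0 ≤ f i) (hP : ∀ i ∈ s, P i → t ≤ f i) (hT : ∑ i ∈ s, f i ≤ T) :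
    ((s.filter P).card : ℝ) * t ≤ T := by
  rw [← nsmul_eq_mul]
  refine le_trans (Finset.card_nsmul_le_sum _ f t fun i hi => ?_) (le_trans
    (Finset.sum_le_sum_of_subset_of_nonneg (Finset.filter_subset P s) fun i hi _ => hf i hi) hT)
  exact hP i (Finset.mem_filter.1 hi).1 (Finset.mem_filter.1 hi).2

theorem degIn_sdiff_ge {A S : Finset V} (h : A ⊆ S) (x : V) :
    (degIn G S x : ℝ) - A.card ≤ degIn G (S \ A) x := by
  have h1 := degIn_sdiff (G := G) h x
  have h2 := degIn_le_card (G := G) A x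
  have h3 : (degIn G A x : ℝ) ≤ A.card := by exact_mod_cast h2
  rw [h1]
  push_cast
  linarith

/-- A dense graph without long cycles contains a nearly complete set of about half of the vertices
that only one vertex separates from all other sets of large minimum degree. -/
theorem exists_nearly_complete_set [Fintype V] {c : ℕ} {e N : ℝ}
    (hN : (Fintype.card V : ℝ) = N) (hc : ∀ l, IsCycleList G l → l.length ≤ c)
    (he : 1 ≤ 2 * e) (heN : e ≤ 3 / 100000 * N) (hc1 : N / 2 - e ≤ c)
    (hL : c * N - adjPairs G Finset.univ Finset.univ ≤ e * N) :
    ∃ (X : Finset V) (v : V), (X.card : ℝ) + 1 ≤ c ∧ (c : ℝ) - 1 - 4.01 * e ≤ X.card ∧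
      (∀ x ∈ X, c ≤ 2 * degIn G X x + 1) ∧
      ((X.filter fun x => (degIn G X x : ℝ) < 0.26 * N).card : ℝ) ≤ 4.2 * e ∧
      ((X.filter fun x => (degIn G X x : ℝ) < 0.44 * N).card : ℝ) ≤ 16.8 * e ∧
      ∀ T : Finset V, (∀ y ∈ T, c < 2 * degIn G T y) →
        ∀ x ∈ X, ∀ y ∈ T, y ∉ X → y ≠ v → ¬ G.Adj x y := by
  have hN0 : 0 < N := by linarith
  have hc2' : 2 ≤ c := by
    have : (2 : ℝ) ≤ c := by linarith
    exact_mod_cast this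
  have hm1 : ((Fintype.card V / 4 : ℕ) : ℝ) ≤ N / 4 := by
    rw [← hN]; exact_mod_cast Nat.cast_div_le (α := ℝ) (m := Fintype.card V) (n := 4)
  have hm2 : N / 4 - 1 ≤ ((Fintype.card V / 4 : ℕ) : ℝ) := by
    have h : Fintype.card V ≤ 4 * (Fintype.card V / 4) + 3 := by omega
    have h' : (Fintype.card V : ℝ) ≤ 4 * ((Fintype.card V / 4 : ℕ) : ℝ) + 3 := by exact_mod_cast h
    linarith
  -- As c is about N/2, this choice makes m(c-m) about N²/16, far above the deficit e·N.
  set m := Fintype.card V / 4 with hm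
  obtain ⟨H, hmH, hLH, hdegH, hcore⟩ := exists_core (G := G) (c := c) (m := m)
    (L := (c : ℤ) * Fintype.card V - adjPairs G Finset.univ Finset.univ) le_rfl (by omega) (by
      have h : (c * N - adjPairs G Finset.univ Finset.univ : ℝ) < m * (c - m) := by
        have h1 : (N / 4 - 2 * e) * (N / 4 - e) ≤ (m : ℝ) * (c - m) :=
          mul_le_mul (by linarith) (by linarith) (by linarith) (by linarith)
        nlinarith
      rw [← hN] at h
      exact_mod_cast h)
  have hmpos : 0 < m := by
    have : (0 : ℝ) < m := by linarith
    exact_mod_cast this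
  obtain ⟨X, hXH, v, hvH, hvX, hXne, hXc, hsep⟩ :=
    exists_separated_set hc hc2' (Finset.card_pos.1 (by omega)) hdegH
  have hv1 : ∀ x, (degIn G {v} x : ℝ) ≤ 1 := fun x => by
    exact_mod_cast degIn_le_card (G := G) {v} x
  have hdX : ∀ x ∈ X, degIn G H x ≤ degIn G X x + 1 := by
    intro x hx
    have h1 := degIn_sdiff (G := G) hXH x
    have h2 : degIn G (H \ X) x ≤ ({v} : Finset V).card := by
      refine Finset.card_le_card fun y hy => ?_
      simp only [Finset.mem_filter, Finset.mem_sdiff, Finset.mem_singleton] at hy ⊢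
      exact (hsep x hx y hy.1.1 hy.2).resolve_left hy.1.2
    rw [Finset.card_singleton] at h2
    omega
  have hX2 : c ≤ 2 * X.card := by
    obtain ⟨x, hx⟩ := hXne
    have h1 := hdX x hx
    have h2 := hdegH x (hXH hx)
    have h3 := degIn_succ_le_card (G := G) hx
    omega
  have hX2' : (c : ℝ) ≤ 2 * X.card := by exact_mod_cast hX2
  have hXc' : (X.card : ℝ) + 1 ≤ c := by exact_mod_cast hXc
  have hterm : ∀ x ∈ X, (c : ℝ) - X.card - 1 ≤ c - degIn G X x - 2 * degIn G {v} x := by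
    intro x hx
    have h1 := hv1 x
    have h2 : (degIn G X x : ℝ) + 1 ≤ X.card := by exact_mod_cast degIn_succ_le_card hx
    linarith
  -- By Erdős–Gallai the deficit of `H \ X` is nonnegative, so `X` alone carries at most the whole
  -- deficit.
  have hsum : ∑ x ∈ X, ((c : ℝ) - degIn G X x - 2 * degIn G {v} x) ≤ e * N := by
    have h1 := adjPairs_self_eq (G := G) hXH
    have h2 := adjPairs_le_of_separated hsep
    have h3 := adjPairs_self_le_mul hc hc2' (H \ X)
    have h4 := Finset.card_sdiff_add_card_eq_card hXH
    have h5 : (c : ℤ) * X.card - adjPairs G X X - 2 * adjPairs G X {v} ≤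
        (c : ℤ) * Fintype.card V - adjPairs G Finset.univ Finset.univ := by
      refine le_trans ?_ hLH
      rw [h1, ← h4]
      push_cast
      have h2' : (adjPairs G X (H \ X) : ℤ) ≤ adjPairs G X {v} := by exact_mod_cast h2
      have h3' : (adjPairs G (H \ X) (H \ X) : ℤ) ≤ c * (H \ X).card := by exact_mod_cast h3
      linarith
    have h6 : (c : ℝ) * X.card - adjPairs G X X - 2 * adjPairs G X {v} ≤
        (c : ℝ) * Fintype.card V - adjPairs G Finset.univ Finset.univ := by exact_mod_cast h5
    rw [hN] at h6
    refine le_trans (le_of_eq ?_) (h6.trans hL)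
    rw [Finset.sum_sub_distrib, Finset.sum_sub_distrib, ← Finset.mul_sum]
    simp only [adjPairs, Nat.cast_sum, Finset.sum_const, nsmul_eq_mul]
    ring
  have hnonneg : ∀ x ∈ X, 0 ≤ (c : ℝ) - degIn G X x - 2 * degIn G {v} x := fun x hx =>
    le_trans (by linarith) (hterm x hx)
  have hbad : ∀ t : ℝ, ((X.filter fun x => (degIn G X x : ℝ) < t).card : ℝ) * (c - t - 2) ≤
      e * N := fun t => card_filter_mul_le_of_sum_le hnonneg
    (fun x _ hx => by have := hv1 x; linarith) hsum
  refine ⟨X, v, hXc', ?_, fun x hx => ?_, ?_, ?_, ?_⟩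
  · have h1 : (X.card : ℝ) * (c - X.card - 1) ≤ e * N := by
      rw [← nsmul_eq_mul]
      exact (Finset.card_nsmul_le_sum _ _ _ hterm).trans hsum
    by_contra! hcon
    have h2 : (N / 4 - e / 2) * (4.01 * e) ≤ (X.card : ℝ) * (c - X.card - 1) :=
      mul_le_mul (by linarith) (by linarith) (by linarith) (by linarith)
    nlinarith
  · have h1 := hdX x hx
    have h2 := hdegH x (hXH hx)
    omega
  · have h1 := hbad (0.26 * N)
    have h2 : 0.2398 * N ≤ c - 0.26 * N - 2 := by linarith
    by_contra! hcon
    have h3 : 4.2 * e * (0.2398 * N) ≤ _ * (c - 0.26 * N - 2) :=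
      mul_le_mul hcon.le h2 (by linarith) (by linarith)
    nlinarith
  · have h1 := hbad (0.44 * N)
    have h2 : 0.0598 * N ≤ c - 0.44 * N - 2 := by linarith
    by_contra! hcon
    have h3 : 16.8 * e * (0.0598 * N) ≤ _ * (c - 0.44 * N - 2) :=
      mul_le_mul hcon.le h2 (by linarith) (by linarith)
    nlinarith
  · intro T hT x hx y hy hyX hyv hadj
    rcases hsep x hx y (hcore T hT hy) hadj with h | h
    · exact hyX h
    · exact hyv h

/-- Few vertices outside a nearly complete set of nearly maximal size have many neighbours in it. -/
theorem card_filter_degIn_le {c : ℕ} {X Y B : Finset V}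
    (hc : ∀ l, IsCycleList G l → l.length ≤ c) (hc3 : 3 ≤ c) (hXY : Disjoint X Y) {t : ℕ}
    (hXc : X.card ≤ c) (ht : c + 2 + B.card ≤ X.card + t)
    (hX : ∀ x ∈ X, t ≤ degIn G X x) (hXB : ∀ x ∈ X, x ∉ B → c + 2 ≤ 2 * degIn G X x) :
    (Y.filter fun y => t ≤ degIn G X y).card + X.card ≤ c := by
  by_contra! hcon
  -- Just enough vertices are added for a Hamiltonian cycle on `X ∪ D` to have length c+1; `D ∪ B`
  -- is its exceptional set.
  obtain ⟨D, hD, hDc⟩ := Finset.exists_subset_card_eq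
    (show c + 1 - X.card ≤ (Y.filter fun y => t ≤ degIn G X y).card by omega)
  have hDX : Disjoint X D := hXY.mono_right (hD.trans (Finset.filter_subset _ _))
  have hF : (X ∪ D).card = c + 1 := by rw [Finset.card_union_of_disjoint hDX]; omega
  have hDB := Finset.card_union_le D B
  have hsub := Finset.subset_union_left (s₁ := X) (s₂ := D)
  obtain ⟨l, hl, hlen⟩ := exists_hamiltonian_cycle (G := G) (F := X ∪ D) (D := D ∪ B) (by omega)
    (fun x hx => by
      have h1 := degIn_mono (G := G) hsub x
      rcases Finset.mem_union.1 hx with hx | hx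
      · have := hX x hx; omega
      · have := (Finset.mem_filter.1 (hD hx)).2; omega)
    (fun x hx hxn => by
      have h1 := degIn_mono (G := G) hsub x
      simp only [Finset.mem_union, not_or] at hx hxn
      have := hXB x (hx.resolve_right hxn.1) hxn.2
      omega)
  have := hc l hl
  omega

/-- The estimate for the number of missing pairs in the part of size `r`, where `z` and `s` are the
sizes of the two other parts, `P` and `Q` count the adjacent pairs in the graph and in the part, and
`t` bounds the degrees from the part of size `r` to that of size `s`. -/
theorem sq_sub_le_of_pairs_le {r z s c e t N P Q : ℝ} (hr : 0 ≤ r) (hz : 0 ≤ z) (hs : 0 ≤ s)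
    (he : 0 < e) (hc1 : N / 2 - e ≤ c) (hN : r + z + s = N) (hsc : s + 1 ≤ c)
    (hsl : c - 1 - 4.01 * e ≤ s) (hzs : z + s ≤ c) (ht : t ≤ 14.3 * e) (he1 : 1 ≤ 2 * e)
    (hrN : r ≤ 0.50022 * N) (hL : c * N - P ≤ e * N)
    (hP : P ≤ s * s + 2 * (z * s + r * t) + (z * z + 2 * (z * r) + Q)) :
    r * r - Q ≤ 25.4 * (e * N) := by
  -- The hypotheses give r² - Q ≤ eN + 2rt + s(s-c) + r(r+z-c) + z(2s+z+r-c); each product is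
  -- bounded separately.
  have h1 : r * t ≤ r * (14.3 * e) := mul_le_mul_of_nonneg_left ht hr
  have h2 : s * (s - c) ≤ 0 := mul_nonpos_of_nonneg_of_nonpos hs (by linarith)
  have h3 : r * (r + z - c) ≤ r * (8.01 * e) := mul_le_mul_of_nonneg_left (by linarith) hr
  have h4 : z * (2 * s + z + r - c) ≤ z * N := mul_le_mul_of_nonneg_left (by linarith) hz
  have h4' : z * N ≤ 6.01 * e * N := mul_le_mul_of_nonneg_right (by linarith) (by linarith)
  have h5 : r * (36.61 * e) ≤ 0.50022 * N * (36.61 * e) :=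
    mul_le_mul_of_nonneg_right hrN (by linarith)
  have h6 : 0 ≤ e * N := mul_nonneg he.le (by linarith)
  have h7 : c * N = c * r + c * z + c * s := by rw [← hN]; ring
  rw [h7] at hL
  linarith

/-- A dense graph without long cycles contains a nearly complete set `X` as above and a nearly
complete set `R` that together cover almost all vertices. -/
theorem exists_nearly_complete_set_pair [Fintype V] {c : ℕ} {e N : ℝ}
    (hN : (Fintype.card V : ℝ) = N) (hc : ∀ l, IsCycleList G l → l.length ≤ c)
    (he : 1 ≤ 2 * e) (heN : e ≤ 3 / 100000 * N) (hc1 : N / 2 - e ≤ c) (hc2 : c ≤ N / 2 + e)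
    (hL : c * N - adjPairs G Finset.univ Finset.univ ≤ e * N) :
    ∃ (X R : Finset V) (v : V), Disjoint X R ∧ (X.card : ℝ) + 1 ≤ c ∧
      (c : ℝ) - 1 - 4.01 * e ≤ X.card ∧
      ((X.filter fun x => (degIn G X x : ℝ) < 0.44 * N).card : ℝ) ≤ 16.8 * e ∧
      (R.card : ℝ) + X.card ≤ N ∧ N - 6.01 * e ≤ R.card + X.card ∧
      (R.card : ℝ) * R.card - adjPairs G R R ≤ 25.4 * (e * N) ∧
      ∀ T : Finset V, (∀ y ∈ T, c < 2 * degIn G T y) →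
        ∀ x ∈ X, ∀ y ∈ T, y ∉ X → y ≠ v → ¬ G.Adj x y := by
  obtain ⟨X, v, hXc, hXl, hXdeg, hX26, hX44, hsep⟩ := exists_nearly_complete_set hN hc he heN hc1 hL
  have hN0 : 0 < N := by linarith
  have he0 : 0 < e := by linarith
  set X₁ := X.filter fun x => (degIn G X x : ℝ) < 0.26 * N with hX₁
  have hXc' : X.card + 1 ≤ c := by exact_mod_cast hXc
  -- The least threshold that `card_filter_degIn_le` permits when `X₁` is the exceptional set.
  obtain ⟨t, ht⟩ : ∃ t, X.card + t = c + 2 + X₁.card := ⟨c + 2 + X₁.card - X.card, by omega⟩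
  have ht' : (X.card : ℝ) + t = c + 2 + X₁.card := by exact_mod_cast ht
  have ht14 : (t : ℝ) ≤ 14.3 * e := by linarith
  set Y := Finset.univ \ X with hY
  set Z := Y.filter fun y => t ≤ degIn G X y with hZ
  have hZc : Z.card + X.card ≤ c := by
    refine card_filter_degIn_le (B := X₁) hc ?_ Finset.disjoint_sdiff (by omega) (by omega) ?_ ?_
    · have : (3 : ℝ) ≤ c := by linarith
      exact_mod_cast this
    · intro x hx
      have h1 : (c : ℝ) ≤ 2 * degIn G X x + 1 := by exact_mod_cast hXdeg x hx
      have : (t : ℝ) ≤ degIn G X x := by linarith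
      exact_mod_cast this
    · intro x hx hx1
      have h1 : 0.26 * N ≤ degIn G X x := by
        by_contra! h
        exact hx1 (Finset.mem_filter.2 ⟨hx, h⟩)
      have : (c : ℝ) + 2 ≤ 2 * degIn G X x := by linarith
      exact_mod_cast this
  have hZY : Z ⊆ Y := Finset.filter_subset _ _
  set R := Y \ Z with hR
  have hRZ : R.card + Z.card = Y.card := Finset.card_sdiff_add_card_eq_card hZY
  have hYX : Y.card + X.card = Fintype.card V :=
    Finset.card_sdiff_add_card_eq_card (Finset.subset_univ X)
  have hcards : (R.card : ℝ) + Z.card + X.card = N := by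
    rw [← hN, ← hYX, ← hRZ]; push_cast; ring
  have hZc' : (Z.card : ℝ) + X.card ≤ c := by exact_mod_cast hZc
  have hz0 : (0 : ℝ) ≤ Z.card := Nat.cast_nonneg _
  have hr0 : (0 : ℝ) ≤ R.card := Nat.cast_nonneg _
  have hs0 : (0 : ℝ) ≤ X.card := Nat.cast_nonneg _
  have hrle : (R.card : ℝ) ≤ 0.50022 * N := by linarith
  have hRX : adjPairs G R X ≤ R.card * t := by
    rw [← smul_eq_mul]
    refine Finset.sum_le_card_nsmul _ _ _ fun y hy => ?_
    have h1 := Finset.mem_sdiff.1 hy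
    by_contra! h
    exact h1.2 (Finset.mem_filter.2 ⟨h1.1, h.le⟩)
  have hpairs : adjPairs G Finset.univ Finset.univ ≤ X.card * X.card +
      2 * (Z.card * X.card + R.card * t) + (Z.card * Z.card + 2 * (Z.card * R.card) +
        adjPairs G R R) := by
    rw [adjPairs_self_eq (Finset.subset_univ X), adjPairs_self_eq hZY, adjPairs_sdiff_right hZY X,
      adjPairs_comm X Z, adjPairs_comm X (Y \ Z)]
    have h1 := adjPairs_le_mul (G := G) X X
    have h2 := adjPairs_le_mul (G := G) Z X
    have h3 := adjPairs_le_mul (G := G) Z Z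
    have h4 := adjPairs_le_mul (G := G) Z R
    exact Nat.add_le_add (Nat.add_le_add h1 (Nat.mul_le_mul_left 2 (Nat.add_le_add h2 hRX)))
      (Nat.add_le_add (Nat.add_le_add h3 (Nat.mul_le_mul_left 2 h4)) le_rfl)
  have hpairs' : (adjPairs G Finset.univ Finset.univ : ℝ) ≤ X.card * X.card +
      2 * (Z.card * X.card + R.card * t) + (Z.card * Z.card + 2 * (Z.card * R.card) +
        adjPairs G R R) := by exact_mod_cast hpairs
  refine ⟨X, R, v, ?_, hXc, hXl, hX44, by linarith, by linarith, ?_, hsep⟩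
  · exact Finset.disjoint_sdiff.mono_right Finset.sdiff_subset
  · exact sq_sub_le_of_pairs_le hr0 hz0 hs0 he0 hc1 hcards hXc hXl hZc' ht14 he hrle hL hpairs'

/-- A dense graph without long cycles contains two nearly complete sets of about half of the
vertices each, with no edges between them. -/
theorem exists_two_nearly_complete_sets [Fintype V] {c : ℕ} {e N : ℝ}
    (hN : (Fintype.card V : ℝ) = N) (hc : ∀ l, IsCycleList G l → l.length ≤ c)
    (he : 1 ≤ 2 * e) (heN : e ≤ 3 / 100000 * N) (hc1 : N / 2 - e ≤ c) (hc2 : c ≤ N / 2 + e)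
    (hL : c * N - adjPairs G Finset.univ Finset.univ ≤ e * N) :
    ∃ A B : Finset V, Disjoint A B ∧ (∀ x ∈ A, ∀ y ∈ B, ¬ G.Adj x y) ∧
      N - A.card - B.card < 840 * e ∧
      (N / 2 - 840 * e < A.card ∧ A.card < N / 2 + 20 * e) ∧
      (N / 2 - 840 * e < B.card ∧ B.card < N / 2 + 20 * e) ∧
      (∀ x ∈ A, 3 * N / 7 ≤ degIn G A x) ∧ ∀ x ∈ B, 3 * N / 7 ≤ degIn G B x := by
  obtain ⟨X, R, v, hXR, hXc, hXl, hX44, hRX1, hRX2, hmiss, hsep⟩ :=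
    exists_nearly_complete_set_pair hN hc he heN hc1 hc2 hL
  have hN0 : 0 < N := by linarith
  have he0 : 0 < e := by linarith
  have hrge : 0.49978 * N ≤ R.card := by linarith
  set X₂ := X.filter fun x => (degIn G X x : ℝ) < 0.44 * N with hX₂
  set R₁ := R.filter fun y => (degIn G R y : ℝ) < 0.4486 * N with hR₁
  have hR₁c : (R₁.card : ℝ) ≤ 500 * e := by
    have h1 : (R₁.card : ℝ) * (R.card - 0.4486 * N) ≤ 25.4 * (e * N) := by
      refine card_filter_mul_le_of_sum_le (f := fun y => (R.card : ℝ) - degIn G R y)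
        (fun y _ => ?_) (fun y _ hy => by linarith) ?_
      · have : (degIn G R y : ℝ) ≤ R.card := by exact_mod_cast degIn_le_card R y
        linarith
      · rw [Finset.sum_sub_distrib, Finset.sum_const, nsmul_eq_mul]
        simpa [adjPairs] using hmiss
    by_contra! hcon
    have h3 : 500 * e * (0.0511 * N) ≤ R₁.card * (R.card - 0.4486 * N) :=
      mul_le_mul hcon.le (by linarith) (by linarith) (by linarith)
    nlinarith
  have hR₁R : R₁ ⊆ R := Finset.filter_subset _ _
  have hX₂X : X₂ ⊆ X := Finset.filter_subset _ _
  have hdegR : ∀ y ∈ R \ R₁, 0.4336 * N ≤ degIn G (R \ R₁) y := by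
    intro y hy
    have h1 := degIn_sdiff_ge (G := G) hR₁R y
    have h2 := Finset.mem_sdiff.1 hy
    have h3 : 0.4486 * N ≤ degIn G R y := by
      by_contra! h
      exact h2.2 (Finset.mem_filter.2 ⟨h2.1, h⟩)
    linarith
  have hdegX : ∀ x ∈ X \ X₂, 0.439 * N ≤ degIn G (X \ X₂) x := by
    intro y hy
    have h1 := degIn_sdiff_ge (G := G) hX₂X y
    have h2 := Finset.mem_sdiff.1 hy
    have h3 : 0.44 * N ≤ degIn G X y := by
      by_contra! h
      exact h2.2 (Finset.mem_filter.2 ⟨h2.1, h⟩)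
    linarith
  have hsep' := hsep (R \ R₁) fun y hy => by
    have h1 := hdegR y hy
    have : (c : ℝ) < 2 * degIn G (R \ R₁) y := by linarith
    exact_mod_cast this
  have hRnX : ∀ y ∈ R, y ∉ X := fun y hy => Finset.disjoint_right.1 hXR hy
  have hcR : ((R \ R₁).card : ℝ) + R₁.card = R.card := by
    exact_mod_cast Finset.card_sdiff_add_card_eq_card hR₁R
  have hcX : ((X \ X₂).card : ℝ) + X₂.card = X.card := by
    exact_mod_cast Finset.card_sdiff_add_card_eq_card hX₂X
  have hce : ((R \ R₁).card : ℝ) ≤ ((R \ R₁).erase v).card + 1 := by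
    have := Finset.pred_card_le_card_erase (s := R \ R₁) (a := v)
    exact_mod_cast Nat.sub_le_iff_le_add.1 this
  have hce' : (((R \ R₁).erase v).card : ℝ) ≤ (R \ R₁).card := by
    exact_mod_cast Finset.card_erase_le
  have hR₁0 : (0 : ℝ) ≤ R₁.card := Nat.cast_nonneg _
  have hX₂0 : (0 : ℝ) ≤ X₂.card := Nat.cast_nonneg _
  refine ⟨X \ X₂, (R \ R₁).erase v, ?_, ?_, by linarith, ⟨by linarith, by linarith⟩,
    ⟨by linarith, by linarith⟩, fun x hx => ?_, fun y hy => ?_⟩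
  · refine Finset.disjoint_left.2 fun x hx hx' => ?_
    exact hRnX x (Finset.mem_sdiff.1 (Finset.mem_of_mem_erase hx')).1 (Finset.mem_sdiff.1 hx).1
  · intro x hx y hy
    have hy' := Finset.mem_of_mem_erase hy
    exact hsep' x (Finset.mem_sdiff.1 hx).1 y hy' (hRnX y (Finset.mem_sdiff.1 hy').1)
      (Finset.ne_of_mem_erase hy)
  · have := hdegX x hx
    linarith
  · have h1 := hdegR y (Finset.mem_of_mem_erase hy)
    have h2 : (degIn G (R \ R₁) y : ℝ) ≤ degIn G ((R \ R₁).erase v) y + 1 := by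
      have : (R \ R₁).filter (G.Adj y) ⊆ insert v (((R \ R₁).erase v).filter (G.Adj y)) := by
        intro z hz
        simp only [Finset.mem_filter, Finset.mem_insert, Finset.mem_erase] at hz ⊢
        by_cases hzv : z = v
        · exact Or.inl hzv
        · exact Or.inr ⟨⟨hzv, hz.1⟩, hz.2⟩
      exact_mod_cast (Finset.card_le_card this).trans (Finset.card_insert_le _ _)
    linarith

/-! ### Components after deletion -/

/-- No walk in `W` leaves `B`, and any two vertices of `B` share a neighbour there because each is
adjacent to more than half of `B`. -/
theorem supp_connectedComponentMk_eq {W : Set V} {B : Finset V} (hBW : ∀ x ∈ B, x ∈ W)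
    (hno : ∀ x ∈ B, ∀ y ∈ W, G.Adj x y → y ∈ B) (hdeg : ∀ x ∈ B, B.card < 2 * degIn G B x)
    {x : V} (hx : x ∈ B) :
    ((G.induce W).connectedComponentMk ⟨x, hBW x hx⟩).supp = {y : W | (y : V) ∈ B} := by
  ext y
  rw [SimpleGraph.ConnectedComponent.mem_supp_iff, SimpleGraph.ConnectedComponent.eq,
    Set.mem_ofPred_eq]
  constructor
  · intro h
    obtain ⟨p⟩ := h.symm
    have : ∀ (a b : W), (G.induce W).Walk a b → (a : V) ∈ B → (b : V) ∈ B := by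
      intro a b q
      induction q with
      | nil => exact id
      | cons hadj _ ih => exact fun ha => ih (hno _ ha _ (Subtype.property _) hadj)
    exact this _ _ p hx
  · intro hy
    obtain ⟨z, hz⟩ : (B.filter (G.Adj x) ∩ B.filter (G.Adj y)).Nonempty := by
      have h1 := hdeg x hx
      have h2 := hdeg y hy
      refine Finset.inter_nonempty_of_card_lt_card_add_card (Finset.filter_subset _ _)
        (Finset.filter_subset _ _) ?_
      unfold degIn at h1 h2
      omega
    simp only [Finset.mem_inter, Finset.mem_filter] at hz
    have ha : (G.induce W).Adj y ⟨z, hBW z hz.1.1⟩ := hz.2.2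
    have hb : (G.induce W).Adj ⟨x, hBW x hx⟩ ⟨z, hBW z hz.1.1⟩ := hz.1.2
    exact ha.reachable.trans hb.symm.reachable

theorem ncard_subtype_mem {W : Set V} {B : Finset V} (hBW : ∀ x ∈ B, x ∈ W) :
    {y : W | (y : V) ∈ B}.ncard = B.card := by
  rw [← Set.ncard_image_of_injective _ Subtype.val_injective, ← Set.ncard_coe_finset B]
  congr 1
  ext x
  simp only [Set.mem_image, Set.mem_ofPred_eq, Finset.mem_coe]
  exact ⟨by rintro ⟨y, hy, rfl⟩; exact hy, fun h => ⟨⟨x, hBW x h⟩, h, rfl⟩⟩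

theorem le_minDeg_of_supp_eq [Finite V] {W : Set V} {B : Finset V} (hBW : ∀ x ∈ B, x ∈ W)
    {C : (G.induce W).ConnectedComponent} (hC : C.supp = {y : W | (y : V) ∈ B}) {d : ℕ}
    (hd : ∀ x ∈ B, d ≤ degIn G B x) : d ≤ minDeg C.toSimpleGraph := by
  unfold minDeg
  let _ : Fintype C := Fintype.ofFinite C
  have hne : Nonempty C := C.nonempty_supp.to_subtype
  refine SimpleGraph.le_minDegree_of_forall_le_degree _ _ fun y => ?_
  have hyB : (y.1.1 : V) ∈ B := by
    have := y.2
    rw [← SetLike.mem_coe] at this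
    exact hC.subset this
  refine (hd _ hyB).trans ?_
  rw [← SimpleGraph.card_neighborFinset_eq_degree]
  refine le_trans (Finset.card_le_card ?_) (Finset.card_image_le (f := fun z : C => (z.1.1 : V)))
  intro z hz
  simp only [Finset.mem_filter] at hz
  have hzC : (⟨z, hBW z hz.1⟩ : W) ∈ C.supp := by rw [hC]; exact hz.1
  refine Finset.mem_image.2 ⟨⟨_, hzC⟩, ?_, rfl⟩
  rw [SimpleGraph.mem_neighborFinset]
  exact hz.2

/-- Two dense sets with no edges between them are the components left by deleting the
other vertices. -/
theorem exists_components [Fintype V] {A B : Finset V} (hAB : Disjoint A B)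
    (hno : ∀ x ∈ A, ∀ y ∈ B, ¬ G.Adj x y) (hA0 : A.Nonempty) (hB0 : B.Nonempty)
    (hA : ∀ x ∈ A, A.card < 2 * degIn G A x) (hB : ∀ x ∈ B, B.card < 2 * degIn G B x) :
    ∃ G₁ G₂ : (G.induce ((↑(A ∪ B) : Set V)ᶜ)ᶜ).ConnectedComponent,
      G₁ ≠ G₂ ∧ (∀ C, C = G₁ ∨ C = G₂) ∧ G₁.supp.ncard = A.card ∧ G₂.supp.ncard = B.card ∧
      (∀ d : ℕ, (∀ x ∈ A, d ≤ degIn G A x) → d ≤ minDeg G₁.toSimpleGraph) ∧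
      ∀ d : ℕ, (∀ x ∈ B, d ≤ degIn G B x) → d ≤ minDeg G₂.toSimpleGraph := by
  -- The deleted set is the complement of `A ∪ B`, hence the double complement; generalizing it
  -- avoids rewriting inside dependent types.
  have hW : ((↑(A ∪ B) : Set V)ᶜ)ᶜ = ↑(A ∪ B) := compl_compl _
  generalize ((↑(A ∪ B) : Set V)ᶜ)ᶜ = W at hW ⊢
  subst hW
  have hAW : ∀ x ∈ A, x ∈ (↑(A ∪ B) : Set V) := fun x hx => by simp [hx]
  have hBW : ∀ x ∈ B, x ∈ (↑(A ∪ B) : Set V) := fun x hx => by simp [hx]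
  obtain ⟨a, ha⟩ := hA0
  obtain ⟨b, hb⟩ := hB0
  have hsA := supp_connectedComponentMk_eq hAW (fun x hx y hy hxy => by
    rcases Finset.mem_union.1 (Finset.mem_coe.1 hy) with h | h
    · exact h
    · exact absurd hxy (hno x hx y h)) hA ha
  have hsB := supp_connectedComponentMk_eq hBW (fun x hx y hy hxy => by
    rcases Finset.mem_union.1 (Finset.mem_coe.1 hy) with h | h
    · exact absurd hxy.symm (hno y h x hx)
    · exact h) hB hb
  refine ⟨_, _, fun h => ?_, fun C => ?_, hsA ▸ ncard_subtype_mem hAW, hsB ▸ ncard_subtype_mem hBW,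
    fun d => le_minDeg_of_supp_eq hAW hsA, fun d => le_minDeg_of_supp_eq hBW hsB⟩
  · rw [← h, hsA] at hsB
    have : (⟨a, hAW a ha⟩ : (↑(A ∪ B) : Set V)) ∈ {y : (↑(A ∪ B) : Set V) | (y : V) ∈ B} := by
      rw [← hsB]; exact ha
    exact Finset.disjoint_left.1 hAB ha this
  · obtain ⟨⟨y, hy⟩, rfl⟩ := C.exists_rep
    rcases Finset.mem_union.1 (Finset.mem_coe.1 hy) with h | h
    · left
      have : (⟨y, hy⟩ : (↑(A ∪ B) : Set V)) ∈ {y : (↑(A ∪ B) : Set V) | (y : V) ∈ A} := h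
      rw [← hsA] at this
      exact this
    · right
      have : (⟨y, hy⟩ : (↑(A ∪ B) : Set V)) ∈ {y : (↑(A ∪ B) : Set V) | (y : V) ∈ B} := h
      rw [← hsB] at this
      exact this

/-! ### The circumference and the choice of parameters -/

theorem length_le_circumference [Fintype V] {l : List V} (hl : IsCycleList G l) :
    l.length ≤ circumference G := by
  obtain ⟨v, p, hp, hlen⟩ := exists_walk_of_isCycleList hl
  refine le_csSup ⟨Fintype.card V, ?_⟩ ⟨v, p, hp, hlen⟩
  rintro _ ⟨w, q, hq, rfl⟩
  have h1 := hq.support_nodup.length_le_card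
  simpa using h1

end LongCycle

open LongCycle in
theorem theorem4 {V : Type*} [Fintype V] (G : SimpleGraph V) (α β : ℝ) (n : ℕ)
    (hα0 : 0 < α) (hα : α < 1 / 10 ^ 5) (hβ0 : 0 ≤ β) (hβ : β < 1 / 10 ^ 5)
    (hn : α⁻¹ / 2 ≤ (n : ℝ)) (hV : Fintype.card V = n)
    (hE : (1 / 4 - β) * (n : ℝ) ^ 2 < (G.edgeSet.ncard : ℝ)) :
    (1 / 2 + α) * (n : ℝ) ≤ (circumference G : ℝ) ∨
    ∃ M : Set V, (M.ncard : ℝ) < 840 * (α + 2 * β) * n ∧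
      ∃ G₁ G₂ : (G.induce Mᶜ).ConnectedComponent,
        G₁ ≠ G₂ ∧ (∀ C : (G.induce Mᶜ).ConnectedComponent, C = G₁ ∨ C = G₂) ∧
        (1 / 2 - 840 * (α + 2 * β)) * (n : ℝ) < (G₁.supp.ncard : ℝ) ∧
        G₁.supp.ncard ≤ G₂.supp.ncard ∧
        (G₂.supp.ncard : ℝ) < (1 / 2 + 20 * (α + 2 * β)) * (n : ℝ) ∧
        3 * (n : ℝ) / 7 ≤ (minDeg G₁.toSimpleGraph : ℝ) ∧
        3 * (n : ℝ) / 7 ≤ (minDeg G₂.toSimpleGraph : ℝ) := by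
  classical
  refine or_iff_not_imp_left.2 fun hcirc => ?_
  rw [not_le] at hcirc
  -- The lower bound on `n` enters here: it gives 1 ≤ 2e, so multiples of e absorb all rounding
  -- errors.
  have hαn : 1 / 2 ≤ α * n := by
    have := mul_le_mul_of_nonneg_left hn hα0.le
    rwa [← mul_div_assoc, mul_inv_cancel₀ hα0.ne'] at this
  have hn0 : (0 : ℝ) < n := by
    by_contra! h
    nlinarith
  have hβn : 0 ≤ β * n := by positivity
  have hceil : 0 < ⌈(1 / 2 + α) * (n : ℝ)⌉₊ := Nat.ceil_pos.2 (by positivity)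
  obtain ⟨c, hc⟩ := Nat.exists_eq_succ_of_ne_zero hceil.ne'
  have hcl : (c : ℝ) < (1 / 2 + α) * n := Nat.lt_ceil.1 (by omega)
  have hcu : (1 / 2 + α) * (n : ℝ) ≤ c + 1 := by
    have := Nat.le_ceil ((1 / 2 + α) * (n : ℝ))
    rw [hc] at this
    exact_mod_cast this
  have hcyc : ∀ l, IsCycleList G l → l.length ≤ c := fun l hl => by
    have := length_le_circumference hl
    have := Nat.lt_ceil.2 hcirc
    omega
  set e := (α + 2 * β) * n with he
  have hpairs : 2 * (G.edgeSet.ncard : ℝ) = adjPairs G Finset.univ Finset.univ := by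
    exact_mod_cast two_mul_ncard_edgeSet G
  -- The data are symmetric in the two sets apart from their order by size, so this is applied to
  -- whichever order is right.
  have key : ∀ A B : Finset V, Disjoint A B → (∀ x ∈ A, ∀ y ∈ B, ¬ G.Adj x y) →
      (n : ℝ) - A.card - B.card < 840 * e →
      (n / 2 - 840 * e < A.card ∧ A.card < n / 2 + 20 * e) →
      (n / 2 - 840 * e < B.card ∧ B.card < n / 2 + 20 * e) →
      (∀ x ∈ A, 3 * (n : ℝ) / 7 ≤ degIn G A x) → (∀ x ∈ B, 3 * (n : ℝ) / 7 ≤ degIn G B x) →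
      A.card ≤ B.card →
      ∃ M : Set V, (M.ncard : ℝ) < 840 * (α + 2 * β) * n ∧
      ∃ G₁ G₂ : (G.induce Mᶜ).ConnectedComponent,
        G₁ ≠ G₂ ∧ (∀ C : (G.induce Mᶜ).ConnectedComponent, C = G₁ ∨ C = G₂) ∧
        (1 / 2 - 840 * (α + 2 * β)) * (n : ℝ) < (G₁.supp.ncard : ℝ) ∧
        G₁.supp.ncard ≤ G₂.supp.ncard ∧
        (G₂.supp.ncard : ℝ) < (1 / 2 + 20 * (α + 2 * β)) * (n : ℝ) ∧
        3 * (n : ℝ) / 7 ≤ (minDeg G₁.toSimpleGraph : ℝ) ∧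
        3 * (n : ℝ) / 7 ≤ (minDeg G₂.toSimpleGraph : ℝ) := by
    intro A B hAB hno hcard hA hB hdA hdB hle
    have hen : e ≤ 3 / 100000 * n := mul_le_mul_of_nonneg_right (by linarith) hn0.le
    have hpos : ∀ S : Finset V, (n : ℝ) / 2 - 840 * e < S.card → S.Nonempty := fun S hS => by
      have : (0 : ℝ) < S.card := by linarith
      exact Finset.card_pos.1 (by exact_mod_cast this)
    have hdense : ∀ S : Finset V, (S.card : ℝ) < n / 2 + 20 * e →
        (∀ x ∈ S, 3 * (n : ℝ) / 7 ≤ degIn G S x) → ∀ x ∈ S, S.card < 2 * degIn G S x := by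
      intro S hS hdS x hx
      have h1 := hdS x hx
      have : (S.card : ℝ) < 2 * degIn G S x := by linarith
      exact_mod_cast this
    obtain ⟨G₁, G₂, hne, hall, h1, h2, h3, h4⟩ := exists_components hAB hno (hpos A hA.1)
      (hpos B hB.1) (hdense A hA.2 hdA) (hdense B hB.2 hdB)
    refine ⟨_, ?_, G₁, G₂, hne, hall, ?_, ?_, ?_, ?_, ?_⟩
    · rw [← Finset.coe_compl, Set.ncard_coe_finset]
      have h5 := Finset.card_compl_add_card (A ∪ B)
      rw [Finset.card_union_of_disjoint hAB, hV] at h5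
      have h6 : (((A ∪ B)ᶜ).card : ℝ) + (A.card + B.card) = n := by exact_mod_cast h5
      linarith
    · rw [h1]; linarith [hA.1]
    · rwa [h1, h2]
    · rw [h2]; linarith [hB.2]
    · exact (Nat.le_ceil _).trans (by exact_mod_cast h3 _ fun x hx => Nat.ceil_le.2 (hdA x hx))
    · exact (Nat.le_ceil _).trans (by exact_mod_cast h4 _ fun x hx => Nat.ceil_le.2 (hdB x hx))
  obtain ⟨A, B, hAB, hno, hcard, hA, hB, hdA, hdB⟩ :=
    exists_two_nearly_complete_sets (G := G) (c := c) (e := e) (N := n) (by rw [hV]) hcyc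
      (by linarith) (mul_le_mul_of_nonneg_right (by linarith) hn0.le) (by linarith)
      (by linarith) (by
        have h1 : (c : ℝ) * n ≤ (1 / 2 + α) * n * n := mul_le_mul_of_nonneg_right hcl.le hn0.le
        rw [← hpairs, he]
        linarith)
  rcases le_total A.card B.card with hle | hle
  · exact key A B hAB hno hcard hA hB hdA hdB hle
  · exact key B A hAB.symm (fun x hx y hy h => hno y hy x hx h.symm) (by linarith) hB hA hdB hdA hle
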